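/- Let $n\ge 1$ and let $\mathfrak S_n$ be the set of permutations $\pi=a_1a_2\cdots a_n$ of $\{1,\dots,n\}$. A descent of $\pi$ is an index $i$ with $1\le i\le n-1$ and $a_i>a_{i+1}$. For $0\le k\le n-1$ let $I_{n,k}$ be the number of involutions in $\mathfrak S_n$ (permutations $\pi$ with $\pi^2=\mathrm{id}$, the identity included) that have exactly $k$ descents. Then the sequence $I_{n,0},I_{n,1},\dots,I_{n,n-1}$ is unimodal, that is, there is an index $0\le j\le n-1$ such that $$I_{n,0}\le I_{n,1}\le\cdots\le I_{n,j}\ge I_{n,j+1}\ge\cdots\ge I_{n,n-1}.$$ -/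

import Mathlib

/-- The finite sequence `a 0, a 1, …, a m` is unimodal: for some `0 ≤ j ≤ m`,
`a 0 ≤ a 1 ≤ ⋯ ≤ a j ≥ a (j + 1) ≥ ⋯ ≥ a m`. -/
def IsUnimodal (m : ℕ) (a : ℕ → ℝ) : Prop :=
  ∃ j ≤ m, (∀ i, i < j → a i ≤ a (i + 1)) ∧ (∀ i, j ≤ i → i < m → a (i + 1) ≤ a i)

/-- The set of descents of a permutation `π` of `{0, …, n - 1}`: the positions `i` such that
`i + 1` is again a position and `π i > π (i + 1)`. -/
def descentSet {n : ℕ} (π : Equiv.Perm (Fin n)) : Finset (Fin n) :=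
  Finset.univ.filter fun i => ∃ h : (i : ℕ) + 1 < n, π i > π ⟨(i : ℕ) + 1, h⟩

/-- The descent number of a permutation. -/
def descentNumber {n : ℕ} (π : Equiv.Perm (Fin n)) : ℕ :=
  (descentSet π).card

/-- The set of involutions among the permutations of an `n`-element set
(the identity counts as an involution). -/
def involutions (n : ℕ) : Finset (Equiv.Perm (Fin n)) :=
  Finset.univ.filter fun π => ∀ i, π (π i) = i

/-- The number of involutions of an `n`-element set with exactly `k` descents. -/
def involutionCount (n k : ℕ) : ℕ :=
  ((involutions n).filter fun π => descentNumber π = k).card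

/-! Call `s : Fin n → Fin (r + 1)` compatible with `π` if it increases weakly, and strictly at
descents. There are `(n + r - des π).choose n` such `s`. Over all involutions `π`, the pairs `(π,
s)` correspond to symmetric `(r + 1) × (r + 1)` matrices over `ℕ` with sum `n`, via the multiset of
pairs `(s i, s (π i))`. Hence the descent polynomial `A n` of the involutions satisfies `A n / (1 -
X) ^ (n + 1) = ∑ S n r * X ^ r`, where `S n r` counts these matrices.

Double counting entries gives a recurrence for `S` in `n` whose coefficients are polynomials in `r +
1`. Multiplication by `r + 1` is the operator `θ F = (X F)'`, so clearing denominators gives a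
five-term recurrence for the descent counts. It preserves symmetry of the rows, and by induction
each row increases up to its middle; symmetry gives the decrease. -/

/-- Nonnegative arrays satisfying the five-term recurrence of the Eulerian distribution
on involutions. -/
structure IsInvolutionEulerian (a : ℕ → ℤ → ℤ) : Prop where
  nonneg : ∀ n k, 0 ≤ a n k
  zero : ∀ k, a 0 k = if k = 0 then 1 else 0
  one : ∀ k, a 1 k = if k = 0 then 1 else 0
  recurrence : ∀ (n : ℕ) (k : ℤ), ((n : ℤ) + 2) * a (n + 2) k =
    (k + 1) * a (n + 1) k + (n + 2 - k) * a (n + 1) (k - 1) + ((k + 1) ^ 2 + n) * a n k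
      + (2 * k * (n + 1 - k) - n + 1) * a n (k - 1) + ((n + 2 - k) ^ 2 + n) * a n (k - 2)

namespace IsInvolutionEulerian

variable {a : ℕ → ℤ → ℤ}

theorem eq_zero_of_neg (ha : IsInvolutionEulerian a) (n : ℕ) : ∀ k < 0, a n k = 0 := by
  induction n using Nat.twoStepInduction with
  | zero => intro k hk; rw [ha.zero, if_neg hk.ne]
  | one => intro k hk; rw [ha.one, if_neg hk.ne]
  | more n h₀ h₁ =>
    intro k hk
    have h := ha.recurrence n k
    rw [h₀ k hk, h₀ (k - 1) (by lia), h₀ (k - 2) (by lia), h₁ k hk, h₁ (k - 1) (by lia)] at h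
    have hn : (n : ℤ) + 2 ≠ 0 := by positivity
    simpa [hn] using h

theorem two (ha : IsInvolutionEulerian a) (k : ℤ) :
    a 2 k = if k = 0 ∨ k = 1 then 1 else 0 := by
  have h := ha.recurrence 0 k
  simp only [zero_add, ha.zero, ha.one] at h
  split_ifs with hk
  · rcases hk with rfl | rfl <;> norm_num at h <;> lia
  · push Not at hk
    by_cases h2 : k = 2
    · subst h2; norm_num at h; lia
    · rw [if_neg hk.1, if_neg (by lia), if_neg (by lia)] at h
      simpa using h

/-- Reflecting `k` permutes the terms of the recurrence. Row 0 is not symmetric about `-1/2`, so the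
induction starts from rows 1 and 2. -/
theorem symm (ha : IsInvolutionEulerian a) (n : ℕ) :
    ∀ k, a (n + 1) (n - k) = a (n + 1) k := by
  induction n using Nat.twoStepInduction with
  | zero => intro k; simp [ha.one]
  | one => intro k; simp only [Nat.reduceAdd, ha.two]; congr 1; grind
  | more n h₀ h₁ =>
    intro k
    have hk := ha.recurrence (n + 1) k
    have hs := ha.recurrence (n + 1) ((n + 2 : ℕ) - k)
    have e₀ := h₀ k
    have e₁ := h₀ (k - 1)
    have e₂ := h₀ (k - 2)
    have f₀ := h₁ k
    have f₁ := h₁ (k - 1)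
    push_cast at hk hs e₀ e₁ e₂ f₀ f₁ ⊢
    rw [show (n : ℤ) + 2 - k - 2 = n - k by ring, show (n : ℤ) + 2 - k - 1 = n + 1 - k by ring] at hs
    rw [show (n : ℤ) - (k - 1) = n + 1 - k by ring] at e₁
    rw [show (n : ℤ) - (k - 2) = n + 2 - k by ring] at e₂
    rw [show (n : ℤ) + 1 - (k - 1) = n + 2 - k by ring] at f₁
    rw [e₀, e₁, e₂, f₀, f₁] at hs
    have hn : (n : ℤ) + 1 + 2 ≠ 0 := by positivity
    refine mul_left_cancel₀ hn ?_
    linear_combination hs - hk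

/-- Within each earlier row, the coefficients of the recurrence have a sum independent of `k`.
Subtracting its instances at `k` and `k - 1` therefore leaves a combination of consecutive
differences only. All but possibly one of these are nonnegative by induction and symmetry. -/
theorem le_of_two_mul_le (ha : IsInvolutionEulerian a) (n : ℕ) :
    ∀ k : ℤ, 2 * k ≤ n → a (n + 1) (k - 1) ≤ a (n + 1) k := by
  have triv : ∀ n, ∀ k ≤ 0, a n (k - 1) ≤ a n k := fun n k hk => by
    rw [ha.eq_zero_of_neg n (k - 1) (by lia)]; exact ha.nonneg n k
  induction n using Nat.twoStepInduction with
  | zero => intro k hk; exact triv _ k (by lia)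
  | one => intro k hk; exact triv _ k (by lia)
  | more n h₀ h₁ =>
    intro k hk
    rcases le_or_gt k 0 with hk0 | hk0
    · exact triv _ k hk0
    push_cast at hk
    have hN : (0 : ℤ) < (n : ℤ) + 1 + 2 := by positivity
    refine le_of_mul_le_mul_left ?_ hN
    have r₀ := ha.recurrence (n + 1) k
    have r₁ := ha.recurrence (n + 1) (k - 1)
    push_cast at r₀ r₁
    rw [show k - 1 - 1 = k - 2 by ring, show k - 1 - 2 = k - 3 by ring] at r₁
    rw [r₀, r₁, ← sub_nonneg]
    have d₁ : 0 ≤ a (n + 1 + 1) k - a (n + 1 + 1) (k - 1) := by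
      rcases le_or_gt (2 * k) (n + 1) with h | h
      · exact sub_nonneg.2 (h₁ k (by push_cast; exact h))
      · have := ha.symm (n + 1) k
        rw [show ((n + 1 : ℕ) : ℤ) - k = k - 1 by push_cast; lia] at this
        rw [this, sub_self]
    have d₁' : 0 ≤ a (n + 1 + 1) (k - 1) - a (n + 1 + 1) (k - 2) := by
      have := h₁ (k - 1) (by push_cast; lia)
      rw [show k - 1 - 1 = k - 2 by ring] at this
      exact sub_nonneg.2 this
    have d₀' : 0 ≤ a (n + 1) (k - 1) - a (n + 1) (k - 2) := by
      have := h₀ (k - 1) (by lia)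
      rw [show k - 1 - 1 = k - 2 by ring] at this
      exact sub_nonneg.2 this
    have d₀'' : 0 ≤ a (n + 1) (k - 2) - a (n + 1) (k - 3) := by
      have := h₀ (k - 2) (by lia)
      rw [show k - 2 - 1 = k - 3 by ring] at this
      exact sub_nonneg.2 this
    have c₁ := mul_nonneg (show 0 ≤ k + 1 by lia) d₁
    have c₁' := mul_nonneg (show 0 ≤ (n : ℤ) + 4 - k by lia) d₁'
    have c₀'' := mul_nonneg (show 0 ≤ ((n : ℤ) + 4 - k) ^ 2 + n + 1 by positivity) d₀''
    suffices key : 0 ≤ ((k + 1) ^ 2 + n + 1) * (a (n + 1) k - a (n + 1) (k - 1))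
        + (2 * k * (n + 3 - k) - n + 1) * (a (n + 1) (k - 1) - a (n + 1) (k - 2))
        + (((n : ℤ) + 4 - k) ^ 2 + n + 1) * (a (n + 1) (k - 2) - a (n + 1) (k - 3)) by
      linarith
    have b₁ : 0 ≤ 2 * k * (n + 3 - k) - (n : ℤ) + 1 := by nlinarith
    have hs := ha.symm n k
    rcases lt_or_ge (2 * k) (n + 2) with h | h
    · have d₀ : 0 ≤ a (n + 1) k - a (n + 1) (k - 1) := by
        rcases le_or_gt (2 * k) n with h | h
        · exact sub_nonneg.2 (h₀ k h)
        · rw [show (n : ℤ) - k = k - 1 by lia] at hs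
          rw [hs, sub_self]
      have := mul_nonneg (show 0 ≤ (k + 1) ^ 2 + (n : ℤ) + 1 by positivity) d₀
      have := mul_nonneg b₁ d₀'
      linarith
    -- Here `k` is past the middle of row `n + 1`, and by symmetry its difference at `k` is minus
    -- the one at `k - 1`. The two coefficients combine to `(k - 1) * (k - 3)`, negative only at `k
    -- = 2`, where explicit values of row 3 settle the inequality.
    · have hn : (n : ℤ) = 2 * k - 2 := by lia
      rw [show (n : ℤ) - k = k - 2 by lia] at hs
      rw [← hs]
      by_cases hk2 : k = 2
      · subst hk2
        obtain rfl : n = 2 := by lia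
        have h0 := ha.recurrence 1 0
        have h1 := ha.recurrence 1 1
        norm_num [ha.one, ha.two] at h0 h1 ⊢
        rw [ha.eq_zero_of_neg 3 (-1) (by norm_num)]
        lia
      · have b : 0 ≤ (k - 1) * (k - 3) := by
          rcases (show k = 1 ∨ 3 ≤ k by lia) with rfl | h3
          · norm_num
          · exact mul_nonneg (by lia) (by lia)
        have := mul_nonneg b d₀'
        rw [hn] at c₀'' ⊢
        linarith

theorem isUnimodal (ha : IsInvolutionEulerian a) (n : ℕ) :
    IsUnimodal n (fun k => (a (n + 1) k : ℝ)) := by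
  refine ⟨n / 2, Nat.div_le_self _ _, fun i hi => ?_, fun i hi hin => ?_⟩
  · have := ha.le_of_two_mul_le n (i + 1) (by lia)
    rw [add_sub_cancel_right] at this
    beta_reduce
    exact_mod_cast this
  · suffices a (n + 1) (i + 1) ≤ a (n + 1) i by
      beta_reduce
      exact_mod_cast this
    rw [← ha.symm n i]
    by_cases h : 2 * i + 1 = n
    · rw [show (n : ℤ) - i = i + 1 by lia]
    · have := ha.le_of_two_mul_le n (n - i) (by lia)
      rwa [show (n : ℤ) - i - 1 = n - (i + 1) by ring, ha.symm n] at this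

end IsInvolutionEulerian

/-! ### Generating functions and the five-term recurrence -/

open PowerSeries in
/-- The operator `θ F = (X F)'`, multiplying the coefficient of `X ^ r` by `r + 1`. -/
noncomputable def PowerSeries.succDerivative (F : ℤ⟦X⟧) : ℤ⟦X⟧ := F + X * d⁄dX ℤ F

open PowerSeries in
/-- The action of `PowerSeries.succDerivative` on numerators over powers of `1 - X`. -/
noncomputable def PowerSeries.eulerianStep (m : ℕ) (F : ℤ⟦X⟧) : ℤ⟦X⟧ :=
  succDerivative F - X * succDerivative F + (m : ℤ⟦X⟧) * (X * F)

section

open PowerSeries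

theorem PowerSeries.coeff_succDerivative (F : ℤ⟦X⟧) (r : ℕ) :
    coeff r (succDerivative F) = (r + 1) * coeff r F := by
  cases r with
  | zero => simp [succDerivative]
  | succ r =>
    rw [succDerivative, map_add, coeff_succ_X_mul, coeff_derivative]
    push_cast
    ring

/-- Quotient rule, with `mk 1` as the inverse of `1 - X`. -/
theorem PowerSeries.succDerivative_mul_pow (F : ℤ⟦X⟧) (m : ℕ) :
    succDerivative (F * (mk 1) ^ (m + 1)) = eulerianStep (m + 1) F * (mk 1) ^ (m + 2) := by
  have hu : (mk 1 : ℤ⟦X⟧) * (1 - X) = 1 := mk_one_mul_one_sub_eq_one ℤ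
  have hd : d⁄dX ℤ (mk 1 : ℤ⟦X⟧) = (mk 1) ^ 2 := by
    have h := congrArg (d⁄dX ℤ) hu
    simp only [Derivation.leibniz, map_sub, Derivation.map_one_eq_zero, derivative_X, smul_eq_mul] at h
    linear_combination (mk 1) * h - (d⁄dX ℤ (mk 1 : ℤ⟦X⟧)) * hu
  simp only [succDerivative, eulerianStep, Derivation.leibniz, Derivation.leibniz_pow, hd,
    smul_eq_mul, nsmul_eq_mul, Nat.add_sub_cancel]
  push_cast
  linear_combination (-(F + X * d⁄dX ℤ F) * (mk 1) ^ (m + 1)) * hu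

theorem PowerSeries.coeff_mul_mk_one_pow (f : ℕ → ℤ) (n r : ℕ) :
    coeff r (mk f * (mk 1) ^ (n + 1))
      = ∑ k ∈ Finset.range (r + 1), f k * ((n + (r - k)).choose n : ℤ) := by
  rw [mk_one_pow_eq_mk_choose_add, coeff_mul, Finset.Nat.sum_antidiagonal_eq_sum_range_succ_mk]
  simp only [coeff_mk]

/-- The coefficient of a power series at an integer exponent. -/
noncomputable def PowerSeries.intCoeff (F : ℤ⟦X⟧) (k : ℤ) : ℤ :=
  if k < 0 then 0 else coeff k.toNat F

theorem PowerSeries.intCoeff_natCast (F : ℤ⟦X⟧) (k : ℕ) : intCoeff F k = coeff k F := by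
  rw [intCoeff, if_neg (by lia), Int.toNat_natCast]

theorem PowerSeries.intCoeff_X_mul (F : ℤ⟦X⟧) (k : ℤ) :
    intCoeff (X * F) k = intCoeff F (k - 1) := by
  rcases lt_trichotomy k 0 with h | rfl | h
  · rw [intCoeff, intCoeff, if_pos h, if_pos (by lia)]
  · simp [intCoeff]
  · obtain ⟨k, rfl⟩ : ∃ j : ℕ, k = j + 1 := ⟨(k - 1).toNat, by lia⟩
    rw [intCoeff, intCoeff, if_neg (by lia), if_neg (by lia), add_sub_cancel_right,
      show ((k : ℤ) + 1).toNat = k + 1 by lia, coeff_succ_X_mul, Int.toNat_natCast]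

theorem PowerSeries.intCoeff_succDerivative (F : ℤ⟦X⟧) (k : ℤ) :
    intCoeff (succDerivative F) k = (k + 1) * intCoeff F k := by
  unfold intCoeff
  split_ifs with h
  · simp
  · rw [coeff_succDerivative, Int.toNat_of_nonneg (by lia)]

theorem PowerSeries.intCoeff_add (F G : ℤ⟦X⟧) (k : ℤ) :
    intCoeff (F + G) k = intCoeff F k + intCoeff G k := by
  unfold intCoeff; split_ifs <;> simp

theorem PowerSeries.intCoeff_sub (F G : ℤ⟦X⟧) (k : ℤ) :
    intCoeff (F - G) k = intCoeff F k - intCoeff G k := by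
  unfold intCoeff; split_ifs <;> simp

theorem PowerSeries.intCoeff_natCast_mul (m : ℕ) (F : ℤ⟦X⟧) (k : ℤ) :
    intCoeff ((m : ℤ⟦X⟧) * F) k = m * intCoeff F k := by
  unfold intCoeff
  split_ifs
  · simp
  · rw [← nsmul_eq_mul, map_nsmul, nsmul_eq_mul]

theorem PowerSeries.intCoeff_eulerianStep (m : ℕ) (F : ℤ⟦X⟧) (k : ℤ) :
    intCoeff (eulerianStep m F) k = (k + 1) * intCoeff F k + (m - k) * intCoeff F (k - 1) := by
  rw [eulerianStep, intCoeff_add, intCoeff_sub, intCoeff_natCast_mul, intCoeff_X_mul,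
    intCoeff_X_mul, intCoeff_succDerivative, intCoeff_succDerivative]
  ring

/-- A numerator array inherits the five-term recurrence from the quadratic recurrence
of the coefficients of the associated rational functions. -/
theorem isInvolutionEulerian_of_card_recurrence (f S : ℕ → ℕ → ℕ)
    (hS : ∀ n r, (n + 2) * S (n + 2) r = (r + 1) * S (n + 1) r + ((r + 1) ^ 2 + n) * S n r)
    (hf : ∀ n r, ∑ k ∈ Finset.range (r + 1), f n k * (n + (r - k)).choose n = S n r)
    (h0 : ∀ k, f 0 k = if k = 0 then 1 else 0) (h1 : ∀ k, f 1 k = if k = 0 then 1 else 0) :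
    IsInvolutionEulerian
      fun n k => intCoeff (mk fun k => (f n k : ℤ)) k where
  nonneg n k := by
    unfold intCoeff
    split_ifs
    · exact le_rfl
    · simp
  zero k := by
    unfold intCoeff
    simp only [coeff_mk, h0]
    split_ifs <;> lia
  one k := by
    unfold intCoeff
    simp only [coeff_mk, h1]
    split_ifs <;> lia
  recurrence n k := by
    set A : ℕ → ℤ⟦X⟧ := fun n => mk fun k => (f n k : ℤ) with hA
    have hG : ∀ n r, coeff r (A n * (mk 1) ^ (n + 1)) = (S n r : ℤ) := fun n r => by
      rw [hA, coeff_mul_mk_one_pow, ← hf]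
      push_cast
      rfl
    have hu : (mk 1 : ℤ⟦X⟧) * (1 - X) = 1 := mk_one_mul_one_sub_eq_one ℤ
    have key : ((n + 2 : ℕ) : ℤ⟦X⟧) * (A (n + 2) * (mk 1) ^ (n + 3))
        = succDerivative (A (n + 1) * (mk 1) ^ (n + 2))
          + succDerivative (succDerivative (A n * (mk 1) ^ (n + 1)))
          + (n : ℤ⟦X⟧) * (A n * (mk 1) ^ (n + 1)) := by
      ext r
      rw [map_add, map_add, coeff_succDerivative, coeff_succDerivative, coeff_succDerivative,
        ← nsmul_eq_mul, ← nsmul_eq_mul, map_nsmul, map_nsmul, hG, hG, hG]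
      have := congrArg (Nat.cast : ℕ → ℤ) (hS n r)
      push_cast at this
      simp only [nsmul_eq_mul]
      push_cast
      linear_combination this
    -- Now every term is a numerator times a power of `mk 1`; multiplying by `(1 - X) ^ (n + 3)`
    -- leaves the factor `(1 - X) ^ 2` on the last one.
    rw [succDerivative_mul_pow, succDerivative_mul_pow, succDerivative_mul_pow] at key
    have hA2 : ((n + 2 : ℕ) : ℤ⟦X⟧) * A (n + 2) = eulerianStep (n + 2) (A (n + 1))
        + eulerianStep (n + 2) (eulerianStep (n + 1) (A n))
        + (n : ℤ⟦X⟧) * (A n - X * A n - (X * A n - X * (X * A n))) := by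
      have hpow : (mk 1 : ℤ⟦X⟧) ^ (n + 3) * (1 - X) ^ (n + 3) = 1 := by
        rw [← mul_pow, hu, one_pow]
      have hpow' : (mk 1 : ℤ⟦X⟧) ^ (n + 1) * (1 - X) ^ (n + 3) = (1 - X) ^ 2 := by
        rw [show n + 3 = n + 1 + 2 from rfl, pow_add (1 - X), ← mul_assoc, ← mul_pow, hu, one_pow,
          one_mul]
      linear_combination (1 - X) ^ (n + 3) * key
        - (((n + 2 : ℕ) : ℤ⟦X⟧) * A (n + 2) - eulerianStep (n + 2) (A (n + 1))
            - eulerianStep (n + 2) (eulerianStep (n + 1) (A n))) * hpow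
        + (n : ℤ⟦X⟧) * A n * hpow'
    have := congrArg (fun F => intCoeff F k) hA2
    simp only [intCoeff_add, intCoeff_sub, intCoeff_natCast_mul, intCoeff_X_mul,
      intCoeff_eulerianStep, show k - 1 - 1 = k - 2 by ring] at this
    push_cast at this
    rw [this]
    ring

end

/-! ### Counting symmetric matrices -/

section SymmetricMultisets

variable (α : Type*) [Fintype α] [DecidableEq α]

/-- The multisets of `n` ordered pairs that are invariant under swapping the entries of all pairs;
equivalently, symmetric matrices of natural numbers with total sum `n`. -/
def symmetricMultisets (n : ℕ) : Finset (Multiset (α × α)) :=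
  ((Finset.univ : Finset (Sym (α × α) n)).image Sym.toMultiset).filter
    fun m => m.map Prod.swap = m

variable {α}

theorem mem_symmetricMultisets {n : ℕ} {m : Multiset (α × α)} :
    m ∈ symmetricMultisets α n ↔ m.card = n ∧ m.map Prod.swap = m := by
  simp only [symmetricMultisets, Finset.mem_filter, Finset.mem_image, Finset.mem_univ, true_and]
  refine and_congr_left fun _ => ⟨?_, fun h => ⟨⟨m, h⟩, rfl⟩⟩
  rintro ⟨m, rfl⟩
  exact m.2

/-- Adding the smallest symmetric multiset `e` containing `p` is a bijection onto the multisets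
containing `p`, and raises the multiplicity of `p` by one. -/
theorem sum_count_symmetricMultisets_add (p : α × α) {e : Multiset (α × α)}
    (he : e.map Prod.swap = e) (hp : e.count p = 1)
    (hle : ∀ m : Multiset (α × α), m.map Prod.swap = m → p ∈ m → e ≤ m) (n : ℕ) :
    ∑ m ∈ symmetricMultisets α (n + e.card), m.count p
      = ∑ m ∈ symmetricMultisets α n, m.count p + (symmetricMultisets α n).card := by
  rw [Finset.card_eq_sum_ones, ← Finset.sum_add_distrib]
  symm
  refine Finset.sum_of_injOn (fun m => m + e) (fun _ _ _ _ h => add_right_cancel h) ?_ ?_ ?_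
  · intro m hm
    simp only [Finset.mem_coe, mem_symmetricMultisets] at hm ⊢
    simp [hm.1, hm.2, he]
  · intro m hm hme
    by_contra hc
    rw [mem_symmetricMultisets] at hm
    have hem := hle m hm.2 (Multiset.count_ne_zero.1 hc)
    refine hme ⟨m - e, ?_, Multiset.sub_add_cancel hem⟩
    obtain ⟨t, rfl⟩ := Multiset.le_iff_exists_add.1 hem
    simp only [Finset.mem_coe, mem_symmetricMultisets, add_tsub_cancel_left]
    obtain ⟨h1, h2⟩ := hm
    rw [Multiset.map_add, he] at h2
    refine ⟨?_, add_left_cancel h2⟩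
    rw [Multiset.card_add] at h1
    lia
  · intro m _
    rw [Multiset.count_add, hp]

theorem sum_count_symmetricMultisets (p : α × α) (n : ℕ) :
    ∑ m ∈ symmetricMultisets α (n + 2), m.count p
      = ∑ m ∈ symmetricMultisets α n, m.count p + (symmetricMultisets α n).card
        + if p.1 = p.2 then (symmetricMultisets α (n + 1)).card else 0 := by
  obtain ⟨x, y⟩ := p
  split_ifs with h
  · obtain rfl : x = y := h
    have key := sum_count_symmetricMultisets_add (x, x) (e := {(x, x)}) (by simp) (by simp)
      (fun m _ hm => Multiset.singleton_le.2 hm)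
    simp only [Multiset.card_singleton] at key
    rw [show n + 2 = (n + 1) + 1 from rfl, key, key]
  · have hne : (x, y) ≠ (y, x) := fun e => h (congrArg Prod.fst e)
    have key := sum_count_symmetricMultisets_add (x, y) (e := {(x, y), (y, x)})
      (by simpa using Multiset.pair_comm _ _) (by simp [hne]) (fun m hm hxy => by
        rw [Multiset.le_iff_subset (by simp [hne])]
        intro q hq
        have hyx : (y, x) ∈ m := by
          rw [← hm]; exact Multiset.mem_map_of_mem Prod.swap hxy
        simp only [Multiset.insert_eq_cons, Multiset.mem_cons, Multiset.mem_singleton] at hq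
        rcases hq with rfl | rfl <;> assumption) n
    simpa using key

/-- Sum the multiplicities of all pairs over all multisets in two ways; only diagonal pairs
contribute the size `n + 1` term. -/
theorem card_symmetricMultisets_recurrence (n : ℕ) :
    (n + 2) * (symmetricMultisets α (n + 2)).card
      = Fintype.card α * (symmetricMultisets α (n + 1)).card
        + (Fintype.card α ^ 2 + n) * (symmetricMultisets α n).card := by
  have total : ∀ n, ∑ p : α × α, ∑ m ∈ symmetricMultisets α n, m.count p
      = n * (symmetricMultisets α n).card := fun n => by
    rw [Finset.sum_comm, mul_comm, ← smul_eq_mul, ← Finset.sum_const]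
    refine Finset.sum_congr rfl fun m hm => ?_
    rw [Multiset.sum_count_eq_card (fun _ _ => Finset.mem_univ _)]
    exact (mem_symmetricMultisets.1 hm).1
  have diag : (Finset.univ.filter fun p : α × α => p.1 = p.2).card = Fintype.card α := by
    rw [← Finset.card_univ]
    refine (Finset.card_nbij (fun x : α => (x, x)) (by simp) (fun x _ y _ h => ?_) ?_).symm
    · exact congrArg Prod.fst h
    · rintro ⟨x, y⟩ h
      obtain rfl : x = y := by simpa using h
      exact ⟨x, by simp⟩
  rw [← total (n + 2)]
  simp_rw [sum_count_symmetricMultisets]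
  rw [Finset.sum_add_distrib, Finset.sum_add_distrib, total, ← Finset.sum_filter]
  simp only [Finset.sum_const, Finset.card_univ, Fintype.card_prod, diag, smul_eq_mul]
  ring

end SymmetricMultisets

/-! ### Involutions with compatible sequences as symmetric matrices -/

section Pairs

variable {α : Type*} [LinearOrder α] {n : ℕ}

/-- `s` is weakly increasing, and strictly increasing at each inversion of `π`. -/
def IsCompatible (π : Equiv.Perm (Fin n)) (s : Fin n → α) : Prop :=
  ∀ i j, i < j → s i ≤ s j ∧ (s i = s j → π i < π j)

theorem Monotone.eq_of_map_univ_eq {β : Type*} [PartialOrder β] {f g : Fin n → β}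
    (hf : Monotone f) (hg : Monotone g)
    (h : (Finset.univ : Finset (Fin n)).val.map f = (Finset.univ : Finset (Fin n)).val.map g) :
    f = g := by
  rw [Fin.univ_val_map, Fin.univ_val_map, Multiset.coe_eq_coe] at h
  exact List.ofFn_injective
    (h.eq_of_pairwise' hf.sortedLE_ofFn.pairwise hg.sortedLE_ofFn.pairwise)

/-- The pairs of labels `(s i, s (π i))`, in lexicographic order. -/
def pairLabel (π : Equiv.Perm (Fin n)) (s : Fin n → α) (i : Fin n) : α ×ₗ α :=
  toLex (s i, s (π i))

/-- Swapping the entries of a pair, on the lexicographic product. -/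
def lexSwap (p : α ×ₗ α) : α ×ₗ α := toLex (ofLex p).swap

theorem IsCompatible.monotone {π : Equiv.Perm (Fin n)} {s : Fin n → α}
    (h : IsCompatible π s) : Monotone s :=
  monotone_iff_forall_lt.2 fun i j hij => (h i j hij).1

theorem IsCompatible.monotone_pairLabel {π : Equiv.Perm (Fin n)} {s : Fin n → α}
    (h : IsCompatible π s) : Monotone (pairLabel π s) := by
  refine monotone_iff_forall_lt.2 fun i j hij => Prod.Lex.toLex_le_toLex.2 ?_
  obtain ⟨h1, h2⟩ := h i j hij
  rcases h1.lt_or_eq with h1 | h1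
  · exact Or.inl h1
  · exact Or.inr ⟨h1, h.monotone (h2 h1).le⟩

/-- The word of pairs determines `π`: swapping entries and then permuting by `π` restores the sorted
word, and compatibility makes `π` increase on ties, so `π` is the stable sort. -/
theorem IsCompatible.eq_sort {π : Equiv.Perm (Fin n)} {s : Fin n → α}
    (h : IsCompatible π s) (hπ : ∀ i, π (π i) = i) :
    π = Tuple.sort (lexSwap ∘ pairLabel π s) := by
  have hs : ∀ i, lexSwap (pairLabel π s (π i)) = pairLabel π s i := fun i => by
    simp [lexSwap, pairLabel, hπ]
  rw [Tuple.eq_sort_iff]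
  refine ⟨?_, fun i j hij he => ?_⟩
  · rw [show (lexSwap ∘ pairLabel π s) ∘ π = pairLabel π s from funext hs]
    exact h.monotone_pairLabel
  · simp only [Function.comp_apply, hs] at he
    exact (h i j hij).2 (congrArg (fun p => (ofLex p).1) he)

theorem IsCompatible.injective_pairLabel {π π' : Equiv.Perm (Fin n)} {s s' : Fin n → α}
    (h : IsCompatible π s) (hπ : ∀ i, π (π i) = i)
    (h' : IsCompatible π' s') (hπ' : ∀ i, π' (π' i) = i)
    (he : pairLabel π s = pairLabel π' s') : π = π' ∧ s = s' := by
  refine ⟨?_, funext fun i => congrArg (fun p => (ofLex p).1) (congrFun he i)⟩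
  rw [h.eq_sort hπ, h'.eq_sort hπ', he]

theorem exists_isCompatible_of_monotone {w : Fin n → α ×ₗ α} (hw : Monotone w)
    (hsymm : (Finset.univ : Finset (Fin n)).val.map (lexSwap ∘ w)
      = (Finset.univ : Finset (Fin n)).val.map w) :
    ∃ (π : Equiv.Perm (Fin n)) (s : Fin n → α),
      (∀ i, π (π i) = i) ∧ IsCompatible π s ∧ pairLabel π s = w := by
  obtain ⟨σ, hσ⟩ : ∃ σ, σ = Tuple.sort (lexSwap ∘ w) := ⟨_, rfl⟩
  obtain ⟨hmono, htie⟩ := Tuple.eq_sort_iff.1 hσ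
  have hws : lexSwap ∘ w ∘ σ = w := by
    refine hmono.eq_of_map_univ_eq hw ?_
    rw [← hsymm, ← Multiset.map_map, Multiset.map_univ_val_equiv σ]
  have hwσ : ∀ i, w (σ i) = lexSwap (w i) := fun i => by
    rw [← congrFun hws i]; simp [lexSwap]
  have htie' : ∀ i j, i < j → w i = w j → σ i < σ j := fun i j hij he =>
    htie i j hij (by simp [hwσ, he])
  have hs : ∀ i, (ofLex (w (σ i))).1 = (ofLex (w i)).2 := fun i => by
    rw [hwσ]; simp [lexSwap]
  have hs1 : Monotone fun i => (ofLex (w i)).1 := fun i j hij =>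
    Prod.Lex.monotone_fst _ _ (hw hij)
  refine ⟨σ, fun i => (ofLex (w i)).1, ?_, ?_, ?_⟩
  -- `σ * σ` fixes the word `w` and preserves the order within ties, so it is increasing, hence the
  -- identity.
  · have hmono2 : StrictMono fun i => σ (σ i) := fun i j hij => by
      rcases (hw hij.le).lt_or_eq with h | h
      · refine lt_of_not_ge fun hge => (hw hge).not_gt ?_
        simpa [hwσ, lexSwap] using h
      · exact htie' _ _ (htie' i j hij h) (by rw [hwσ, hwσ, h])
    intro i
    have h1 := (Equiv.Perm.monotone_iff (σ * σ)).1 hmono2.monotone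
    exact DFunLike.congr_fun h1 i
  · intro i j hij
    refine ⟨hs1 hij.le, fun he => ?_⟩
    rcases (hw hij.le).lt_or_eq with h | h
    · rcases Prod.Lex.lt_iff.1 h with h | ⟨-, h⟩
      · exact absurd he h.ne
      · refine lt_of_not_ge fun hge => (hs1 hge).not_gt ?_
        simpa only [hs] using h
    · exact htie' i j hij h
  · funext i
    simp [pairLabel, hs]

open Classical in
theorem card_compatible_pairs [Fintype α] :
    (Finset.univ.filter fun p : Equiv.Perm (Fin n) × (Fin n → α) =>
      (∀ i, p.1 (p.1 i) = i) ∧ IsCompatible p.1 p.2).card = (symmetricMultisets α n).card := by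
  refine Finset.card_bij
    (fun p _ => ((Finset.univ : Finset (Fin n)).val.map (pairLabel p.1 p.2)).map ofLex) ?_ ?_ ?_
  · rintro ⟨π, s⟩ h
    simp only [Finset.mem_filter, Finset.mem_univ, true_and] at h
    rw [mem_symmetricMultisets]
    refine ⟨by simp, ?_⟩
    conv_rhs => rw [← Multiset.map_univ_val_equiv π]
    simp only [Multiset.map_map]
    refine Multiset.map_congr rfl fun i _ => ?_
    simp [pairLabel, h.1]
  · rintro ⟨π, s⟩ h ⟨π', s'⟩ h' he
    simp only [Finset.mem_filter, Finset.mem_univ, true_and] at h h'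
    have he' := h.2.monotone_pairLabel.eq_of_map_univ_eq h'.2.monotone_pairLabel
      (Multiset.map_injective ofLex.injective he)
    obtain ⟨rfl, rfl⟩ := h.2.injective_pairLabel h.1 h'.2 h'.1 he'
    rfl
  · intro m hm
    obtain ⟨hc, hm⟩ := mem_symmetricMultisets.1 hm
    obtain ⟨f, hf⟩ : ∃ f : Fin n → α ×ₗ α,
        (Finset.univ : Finset (Fin n)).val.map f = m.map toLex := by
      subst hc
      induction m using Quot.inductionOn with
      | _ l =>
        refine ⟨fun i => toLex (l.get i), ?_⟩
        rw [Fin.univ_val_map]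
        exact congrArg _ ((List.map_ofFn (f := l.get) (g := toLex)).symm.trans
          (congrArg (List.map toLex) (List.ofFn_get l)))
    have hw : (Finset.univ : Finset (Fin n)).val.map (f ∘ Tuple.sort f) = m.map toLex := by
      rw [← hf, ← Multiset.map_map, Multiset.map_univ_val_equiv]
    obtain ⟨π, s, hπ, hs, he⟩ := exists_isCompatible_of_monotone (Tuple.monotone_sort f) (by
      rw [← Multiset.map_map, hw, Multiset.map_map]
      conv_rhs => rw [← hm, Multiset.map_map]
      rfl)
    refine ⟨(π, s), by simp [hπ, hs], ?_⟩
    simp only [he]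
    rw [hw, Multiset.map_map]
    exact Multiset.map_id m

end Pairs

/-! ### Counting compatible sequences of one permutation -/

/-- The number of positions before `i` that do not belong to `D`. -/
def countOutside {m : ℕ} (D : Finset (Fin m)) (i : Fin (m + 1)) : ℕ :=
  (Finset.univ.filter fun j : Fin m => j.castSucc < i ∧ j ∉ D).card

section

variable {m : ℕ} (D : Finset (Fin m))

theorem countOutside_succ (i : Fin m) :
    countOutside D i.succ = countOutside D i.castSucc + if i ∈ D then 0 else 1 := by
  unfold countOutside
  split_ifs with h
  · rw [add_zero]
    congr 1
    ext j
    simp only [Finset.mem_filter, Finset.mem_univ, true_and, Fin.castSucc_lt_castSucc_iff,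
      Fin.castSucc_lt_succ_iff]
    exact and_congr_left fun hj => ⟨fun hl => hl.lt_of_ne fun e => hj (e ▸ h), le_of_lt⟩
  · rw [← Finset.card_insert_of_notMem (a := i) (by simp)]
    congr 1
    ext j
    simp only [Finset.mem_filter, Finset.mem_univ, true_and, Fin.castSucc_lt_castSucc_iff,
      Fin.castSucc_lt_succ_iff, Finset.mem_insert, le_iff_lt_or_eq]
    constructor
    · rintro ⟨hj | rfl, hD⟩
      · exact Or.inr ⟨hj, hD⟩
      · exact Or.inl rfl
    · rintro (rfl | ⟨hj, hD⟩)
      · exact ⟨Or.inr rfl, h⟩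
      · exact ⟨Or.inl hj, hD⟩

theorem countOutside_zero : countOutside D 0 = 0 := by
  simp [countOutside]

theorem countOutside_last : countOutside D (Fin.last m) = m - D.card := by
  have : (Finset.univ.filter fun j : Fin m => j.castSucc < Fin.last m ∧ j ∉ D) = Dᶜ := by
    ext j; simp [Fin.castSucc_lt_last]
  rw [countOutside, this, Finset.card_compl, Fintype.card_fin]

theorem countOutside_mono : Monotone (countOutside D) :=
  Fin.monotone_iff_le_succ.2 fun i => by rw [countOutside_succ]; exact Nat.le_add_right _ _

/-- Weakly increasing sequences that increase strictly at the positions in `D` correspond to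
strictly increasing sequences in a longer range. -/
def strictAtEquiv (r : ℕ) :
    {s : Fin (m + 1) → Fin (r + 1) //
      ∀ i : Fin m, s i.castSucc ≤ s i.succ ∧ (i ∈ D → s i.castSucc < s i.succ)} ≃
    (Fin (m + 1) ↪o Fin (m + 1 + r - D.card)) where
  toFun s := OrderEmbedding.ofStrictMono
    -- Adding one after each position outside `D` turns every weak step into a strict one; the range
    -- grows by `m - D.card`.
    (fun i => ⟨s.1 i + countOutside D i, by
      have h1 := countOutside_mono D (Fin.le_last i)
      have h2 := (s.1 i).2
      have h3 := Finset.card_le_univ D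
      rw [countOutside_last] at h1
      rw [Fintype.card_fin] at h3
      lia⟩)
    (Fin.strictMono_iff_lt_succ.2 fun i => by
      obtain ⟨h1, h2⟩ := s.2 i
      rw [Fin.lt_def]
      dsimp only
      rw [countOutside_succ]
      split_ifs with h
      · have := Fin.lt_def.1 (h2 h)
        lia
      · have := Fin.le_def.1 h1
        lia)
  invFun t :=
    have hstep : ∀ i : Fin m, (t i.castSucc : ℕ) < t i.succ := fun i =>
      t.strictMono (Fin.castSucc_lt_succ)
    have hle : ∀ i, countOutside D i ≤ t i := fun i => by
      induction i using Fin.induction with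
      | zero => rw [countOutside_zero]; exact Nat.zero_le _
      | succ i ih =>
        have := hstep i
        rw [countOutside_succ]
        split_ifs <;> lia
    have hmono : Monotone fun i => (t i : ℕ) - countOutside D i :=
      Fin.monotone_iff_le_succ.2 fun i => by
        have := hstep i
        have := hle i.castSucc
        rw [countOutside_succ]
        split_ifs <;> lia
    ⟨fun i => ⟨(t i : ℕ) - countOutside D i, by
      have h1 := hmono (Fin.le_last i)
      have h2 := (t (Fin.last m)).2
      have h3 := Finset.card_le_univ D
      rw [Fintype.card_fin] at h3
      dsimp only at h1
      rw [countOutside_last] at h1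
      lia⟩, fun i => ⟨Fin.le_def.2 (hmono Fin.castSucc_lt_succ.le), fun h => by
        have h1 := hstep i
        have h2 := hle i.castSucc
        rw [Fin.lt_def]
        dsimp only
        rw [countOutside_succ, if_pos h]
        lia⟩⟩
  left_inv s := by
    ext i
    simp
  right_inv t := by
    have hle : ∀ i, countOutside D i ≤ t i := fun i => by
      induction i using Fin.induction with
      | zero => rw [countOutside_zero]; exact Nat.zero_le _
      | succ i ih =>
        have : (t i.castSucc : ℕ) < t i.succ := t.strictMono (Fin.castSucc_lt_succ)
        rw [countOutside_succ]
        split_ifs <;> lia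
    ext i
    simp [hle i]

open Classical in
theorem card_strictAt (r : ℕ) :
    (Finset.univ.filter fun s : Fin (m + 1) → Fin (r + 1) =>
      ∀ i : Fin m, s i.castSucc ≤ s i.succ ∧ (i ∈ D → s i.castSucc < s i.succ)).card
      = (m + 1 + r - D.card).choose (m + 1) := by
  rw [← Fintype.card_subtype, ← Nat.card_eq_fintype_card,
    Nat.card_congr ((strictAtEquiv D r).trans Set.powersetCard.ofFinEmbEquiv),
    Set.powersetCard.card, Nat.card_fin]

end

/-- Compatibility says that `(s i, π i)` is lexicographically strictly increasing, which need only
be tested on neighbours; so inversions reduce to descents. -/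
theorem isCompatible_iff_succ {α : Type*} [LinearOrder α] {m : ℕ} (π : Equiv.Perm (Fin (m + 1)))
    (s : Fin (m + 1) → α) :
    IsCompatible π s ↔ ∀ i : Fin m, s i.castSucc ≤ s i.succ ∧
      (i ∈ Finset.univ.filter (fun i : Fin m => π i.succ < π i.castSucc) →
        s i.castSucc < s i.succ) := by
  have h : ∀ i j, (s i ≤ s j ∧ (s i = s j → π i < π j)) ↔
      toLex (s i, π i) < toLex (s j, π j) := fun i j => by
    rw [Prod.Lex.toLex_lt_toLex, le_iff_lt_or_eq]
    constructor
    · rintro ⟨h | h, h'⟩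
      · exact Or.inl h
      · exact Or.inr ⟨h, h' h⟩
    · rintro (h | h)
      · exact ⟨Or.inl h, fun e => absurd e h.ne⟩
      · exact ⟨Or.inr h.1, fun _ => h.2⟩
  calc IsCompatible π s ↔ StrictMono fun i => toLex (s i, π i) := by
        unfold IsCompatible
        simp only [h]
        exact Iff.rfl
    _ ↔ _ := by
        rw [Fin.strictMono_iff_lt_succ]
        refine forall_congr' fun i => ?_
        rw [← h]
        refine and_congr_right fun hle => ?_
        simp only [Finset.mem_filter, Finset.mem_univ, true_and]
        have hne : π i.castSucc ≠ π i.succ := fun e =>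
          (Fin.castSucc_lt_succ (i := i)).ne (π.injective e)
        constructor
        · exact fun h' hd => hle.lt_of_ne fun e => (h' e).not_gt hd
        · exact fun h' e => lt_of_not_ge fun hge => (h' (hge.lt_of_ne hne.symm)).ne e

theorem descentNumber_eq_card {m : ℕ} (π : Equiv.Perm (Fin (m + 1))) :
    descentNumber π = (Finset.univ.filter fun i : Fin m => π i.succ < π i.castSucc).card := by
  refine Eq.trans (congrArg Finset.card (Finset.ext fun i => ?_)) (Finset.card_map Fin.castSuccEmb)
  simp only [descentSet, Finset.mem_filter, Finset.mem_univ, true_and, Finset.mem_map]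
  constructor
  · rintro ⟨h, hi⟩
    exact ⟨⟨i, by lia⟩, hi, rfl⟩
  · rintro ⟨j, hj, rfl⟩
    exact ⟨by simp, hj⟩

open Classical in
theorem card_isCompatible {n : ℕ} (π : Equiv.Perm (Fin n)) (r : ℕ) :
    (Finset.univ.filter fun s : Fin n → Fin (r + 1) => IsCompatible π s).card
      = if descentNumber π ≤ r then (n + (r - descentNumber π)).choose n else 0 := by
  cases n with
  | zero =>
    have : descentNumber π = 0 := by
      rw [descentNumber, Finset.card_eq_zero]
      exact Finset.eq_empty_of_isEmpty _
    rw [this, if_pos (Nat.zero_le _), Nat.choose_zero_right,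
      Finset.filter_true_of_mem fun s _ i => i.elim0]
    simp
  | succ m =>
    simp only [isCompatible_iff_succ]
    rw [card_strictAt, ← descentNumber_eq_card]
    split_ifs with h
    · rw [Nat.add_sub_assoc h]
    · exact Nat.choose_eq_zero_of_lt (by lia)

/-! ### Assembly -/

/-- Counts the compatible pairs in two ways: grouped by the descent number of the involution, and as
symmetric matrices. -/
theorem sum_involutionCount_mul_choose (n r : ℕ) :
    ∑ k ∈ Finset.range (r + 1), involutionCount n k * (n + (r - k)).choose n
      = (symmetricMultisets (Fin (r + 1)) n).card := by
  classical
  rw [← card_compatible_pairs, Finset.card_filter, Fintype.sum_prod_type]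
  have h : ∀ π : Equiv.Perm (Fin n),
      (∑ s : Fin n → Fin (r + 1), if (∀ i, π (π i) = i) ∧ IsCompatible π s then 1 else 0)
        = if (∀ i, π (π i) = i) then
            ∑ k ∈ Finset.range (r + 1),
              if descentNumber π = k then (n + (r - k)).choose n else 0
          else 0 := fun π => by
    split_ifs with hπ
    · simp only [hπ, implies_true, true_and]
      rw [← Finset.card_filter, card_isCompatible, Finset.sum_ite_eq]
      simp only [Finset.mem_range, Nat.lt_succ_iff]
    · simp [hπ]
  simp_rw [h]
  rw [← Finset.sum_filter, Finset.sum_comm]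
  refine Finset.sum_congr rfl fun k _ => ?_
  rw [← Finset.sum_filter, Finset.sum_const, smul_eq_mul]
  rfl

theorem involutionCount_of_le_one {n : ℕ} (hn : n ≤ 1) (k : ℕ) :
    involutionCount n k = if k = 0 then 1 else 0 := by
  have : Subsingleton (Fin n) := Fin.subsingleton_iff_le_one.2 hn
  have hd : ∀ π : Equiv.Perm (Fin n), descentNumber π = 0 := fun π => by
    rw [descentNumber, Finset.card_eq_zero, descentSet, Finset.filter_eq_empty_iff]
    rintro i - ⟨h, -⟩
    lia
  have hi : involutions n = Finset.univ :=
    Finset.filter_true_of_mem fun π _ i => Subsingleton.elim _ _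
  simp only [involutionCount, hd, hi, eq_comm (a := 0)]
  split_ifs with h
  · simp [h]
  · simp [h]

theorem mainTheorem1 (n : ℕ) (hn : 1 ≤ n) :
    IsUnimodal (n - 1) (fun k => (involutionCount n k : ℝ)) := by
  have key := isInvolutionEulerian_of_card_recurrence involutionCount
    (fun n r => (symmetricMultisets (Fin (r + 1)) n).card)
    (fun n r => by simpa using card_symmetricMultisets_recurrence (α := Fin (r + 1)) n)
    sum_involutionCount_mul_choose (involutionCount_of_le_one zero_le_one)
    (involutionCount_of_le_one le_rfl)
  obtain ⟨m, rfl⟩ : ∃ m, n = m + 1 := ⟨n - 1, by lia⟩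
  have := key.isUnimodal m
  simpa [PowerSeries.intCoeff_natCast] using this
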